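/- \textbf{Formulae.} $A,B ::= 0 \mid 1 \mid A\otimes B \mid A\oplus B \mid {?}A \mid \top \mid \bot \mid A\parr B \mid A\,\&\,B \mid {!}A$. The first five forms are \emph{positive}, the others \emph{negative}; $A^\perp$ is De Morgan duality ($0\leftrightarrow\top$, $1\leftrightarrow\bot$, $\otimes\leftrightarrow\parr$, $\oplus\leftrightarrow\&$, ${?}\leftrightarrow{!}$). Put $\otimes^0A=1$ and $\otimes^{n+1}A=(\otimes^nA)\otimes A$. \textbf{Positions.} A \emph{position} is a finite directed graph whose underlying undirected graph is a tree, together with a label on each edge which is a positive formula, a sign in $\{O,P\}$ for each vertex, and a selected vertex, which holds the token. Positions are considered up to isomorphism. Saying that there is an edge from $x$ to $y$ labelled by a negative formula $F$ means that there is an edge from $y$ to $x$ labelled $F^\perp$. \textbf{Moves.} Let $v$ hold the token in a position. The moves are the following; vertices keep their signs, and copies of a vertex inherit its sign. \begin{itemize} \item \emph{Negative move.} If there is an edge from $v'$ to $v$, pass the token to $v'$. \item \emph{$1$.} If there is an edge from $v$ to $v'$ labelled $1$ and it is the only edge adjacent to $v$, delete $v$ and this edge and pass the token to $v'$. \item \emph{$\oplus$.}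 If there is an edge from $v$ to $v'$ labelled $A\oplus B$, replace its label by $A$, or by $B$ (with the above convention if this is negative), and pass the token to $v'$. \item \emph{${?}$.} If there is an edge from $v$ to $v'$ labelled ${?}(A^\perp)$, replace it, for any $n\in\mathbb N$, by an edge from $v'$ to $v$ labelled $\otimes^nA$, and pass the token to $v'$. \item \emph{$\otimes$.} If there is an edge $e$ from $v$ to $v'$ labelled $A\otimes B$, let $\Delta$ be the component of $v'$ after deletion of $e$, and split the component of $v$ into three subtrees $\Gamma$, $\Theta$, $\Gamma'$ that have exactly the vertex $v$ in common pairwise, such that all edges of $\Theta$ at $v$ go out of $v$ and have labels of the form ${?}C$. The result consists of $\Delta$, of a copy $v_1$ of $v$ carrying $\Gamma$ and a copy of $\Theta$, of a copy $v_2$ of $v$ carrying $\Gamma'$ and another copy of $\Theta$, of an edge from $v_1$ to $v'$ labelled $A$, and of an edge from $v_2$ to $v'$ labelled $B$ (with the above convention if these are negative); the token is at $v'$. \end{itemize} \textbf{Plays.} A \emph{play} from a position $U$ is a finite or infinite sequence of positions that starts at $U$ and in which each position is obtained from the preceding one by a move. \textbf{Theorem.} For every position $U$, all plays from $U$ are finite.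 -/

import Mathlib

namespace LLTN

/-- Formulae of propositional linear logic without propositional variables. -/
inductive Formula : Type
  | zero : Formula
  | one : Formula
  | tensor : Formula → Formula → Formula
  | plus : Formula → Formula → Formula
  | whyNot : Formula → Formula
  | top : Formula
  | bot : Formula
  | par : Formula → Formula → Formula
  | amp : Formula → Formula → Formula
  | ofCourse : Formula → Formula

namespace Formula

/-- De Morgan duality (linear negation). -/
def dual : Formula → Formula
  | zero => top
  | one => bot
  | tensor A B => par A.dual B.dual
  | plus A B => amp A.dual B.dual
  | whyNot A => ofCourse A.dual
  | top => zero
  | bot => one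
  | par A B => tensor A.dual B.dual
  | amp A B => plus A.dual B.dual
  | ofCourse A => whyNot A.dual

/-- The positive formulae are `0`, `1`, `A ⊗ B`, `A ⊕ B` and `?A`; the others are negative. -/
def isPositive : Formula → Bool
  | zero => true
  | one => true
  | tensor _ _ => true
  | plus _ _ => true
  | whyNot _ => true
  | top => false
  | bot => false
  | par _ _ => false
  | amp _ _ => false
  | ofCourse _ => false

/-- The `n`-fold tensor power: `⊗⁰ A = 1` and `⊗ⁿ⁺¹ A = (⊗ⁿ A) ⊗ A`. -/
def tensorPow : ℕ → Formula → Formula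
  | 0, _ => one
  | n + 1, A => tensor (tensorPow n A) A

end Formula

/-- The two signs of vertices: opponents and proponents. -/
inductive Sign : Type
  | O : Sign
  | P : Sign

/-- A punctured, signed, directed graph with edges labelled by formulae: there is an edge from
`x` to `y`, with label `A`, exactly when `label x y = some A`. -/
structure Diagram : Type 1 where
  Vertex : Type
  label : Vertex → Vertex → Option Formula
  sign : Vertex → Sign
  /-- The vertex holding the token. -/
  token : Vertex

namespace Diagram

/-- The underlying undirected graph. -/
def skeleton (G : Diagram) : SimpleGraph G.Vertex :=
  SimpleGraph.fromRel fun x y => (G.label x y).isSome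

/-- `G` is a finite punctured, directed, signed, normally labelled tree. The field `oneWay` says
that there are neither loops nor two opposite edges between two vertices (these are not seen by
the simple graph `skeleton`). -/
structure IsPosition (G : Diagram) : Prop where
  finite : Finite G.Vertex
  oneWay : ∀ x y, (G.label x y).isSome → G.label y x = none
  normal : ∀ x y A, G.label x y = some A → A.isPositive = true
  tree : G.skeleton.IsTree

/-- Isomorphisms of diagrams. -/
structure Iso (G H : Diagram) where
  toEquiv : G.Vertex ≃ H.Vertex
  label_eq : ∀ x y, H.label (toEquiv x) (toEquiv y) = G.label x y
  sign_eq : ∀ x, H.sign (toEquiv x) = G.sign x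
  token_eq : toEquiv G.token = H.token

/-- Pass the token to the vertex `w`. -/
def passTo (G : Diagram) (w : G.Vertex) : Diagram :=
  { G with token := w }

open Classical in
/-- Replace whatever edge there is between `a` and `b` by one edge from `a` to `b` labelled `F`,
in normalised form: when `F` is negative, this means an edge from `b` to `a` labelled by the
dual of `F`. -/
noncomputable def setEdge (G : Diagram) (a b : G.Vertex) (F : Formula) : Diagram :=
  { G with
    label := fun x y =>
      if x = a ∧ y = b then (if F.isPositive then some F else none)
      else if x = b ∧ y = a then (if F.isPositive then none else some F.dual)
      else G.label x y }

/-- Delete the vertex holding the token, with all its edges, and give the token to `w`. -/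
def deleteActive (G : Diagram) (w : G.Vertex) (hw : w ≠ G.token) : Diagram where
  Vertex := {x : G.Vertex // x ≠ G.token}
  label := fun x y => G.label x.1 y.1
  sign := fun x => G.sign x.1
  token := ⟨w, hw⟩

/-- In the tensor move, every vertex but the active one lies in one of the subtrees `Γ`, `?Θ`,
`Γ'` (on the side of the active vertex) and `Δ` (on the side of the passive vertex). -/
inductive Part : Type
  | gamma : Part
  | theta : Part
  | gamma' : Part
  | delta : Part

/-- `part` is a legal splitting of the tree for a tensor move of the active vertex `v` on its
edge to `w`. The value of `part` at `v` is irrelevant: `v` is the common root of `Γ`, `?Θ`, `Γ'`. -/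
structure IsSplitting (G : Diagram) (w : G.Vertex) (part : G.Vertex → Part) : Prop where
  /-- Away from `v`, no edge joins two different parts. -/
  closed : ∀ x y, x ≠ G.token → y ≠ G.token → G.skeleton.Adj x y → part x = part y
  /-- Among the neighbours of `v`, exactly `w` is in `Δ`. -/
  delta_iff : ∀ x, G.skeleton.Adj G.token x → (part x = Part.delta ↔ x = w)
  /-- The edges from `v` into `?Θ` are outputs of `v` labelled by formulae `?C`. -/
  theta_whyNot : ∀ x, G.skeleton.Adj G.token x → part x = Part.theta →
    ∃ C, G.label G.token x = some (Formula.whyNot C)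

/-- The three trees from which the result of a tensor move is assembled: the one around the
first copy of the active vertex, the one around its second copy, and `Δ`. -/
inductive Zone : Type
  | first : Zone
  | second : Zone
  | opposite : Zone

/-- The vertex `x` has a copy in the given zone: the first zone is made of `v`, `Γ` and `?Θ`, the
second one of `v`, `Γ'` and `?Θ`, the opposite one of `Δ`. -/
def InZone (G : Diagram) (part : G.Vertex → Part) (x : G.Vertex) : Zone → Prop
  | Zone.first => x = G.token ∨ part x = Part.gamma ∨ part x = Part.theta
  | Zone.second => x = G.token ∨ part x = Part.gamma' ∨ part x = Part.theta
  | Zone.opposite => x ≠ G.token ∧ part x = Part.delta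

open Classical in
/-- The disjoint union of the three zones, with the token at the passive vertex `w`. -/
noncomputable def zones (G : Diagram) (part : G.Vertex → Part) (w : G.Vertex)
    (hw : G.InZone part w Zone.opposite) : Diagram where
  Vertex := {p : G.Vertex × Zone // G.InZone part p.1 p.2}
  label := fun p q => if p.1.2 = q.1.2 then G.label p.1.1 q.1.1 else none
  sign := fun p => G.sign p.1.1
  token := ⟨(w, Zone.opposite), hw⟩

/-- The result of a tensor move on an edge labelled `A ⊗ B` from the active vertex to `w`: the
three zones, with an edge labelled `A` from the first copy of the active vertex to `w` and an
edge labelled `B` from its second copy to `w` (in normalised form). -/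
noncomputable def splitTensor (G : Diagram) (part : G.Vertex → Part) (w : G.Vertex)
    (hw : G.InZone part w Zone.opposite) (A B : Formula) : Diagram :=
  ((G.zones part w hw).setEdge
      ⟨(G.token, Zone.first), Or.inl rfl⟩ ⟨(w, Zone.opposite), hw⟩ A).setEdge
    ⟨(G.token, Zone.second), Or.inl rfl⟩ ⟨(w, Zone.opposite), hw⟩ B

/-- The moves, with a concrete choice of the vertices of the result. The active vertex is
`G.token`, the passive one is `w`. -/
inductive RawMove (G : Diagram) : Diagram → Prop
  /-- Pass the token along an input edge. -/
  | negative (w : G.Vertex) (A : Formula) (h : G.label w G.token = some A) :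
      RawMove G (G.passTo w)
  /-- On an output `1` that is the sole edge at the active vertex: delete that vertex. -/
  | one (w : G.Vertex) (h : G.label G.token w = some Formula.one)
      (sole : ∀ x, G.skeleton.Adj G.token x → x = w) (hw : w ≠ G.token) :
      RawMove G (G.deleteActive w hw)
  /-- On an output `A ⊗ B`: split the active vertex, both copies keeping `?Θ`. -/
  | tensor (w : G.Vertex) (A B : Formula) (h : G.label G.token w = some (Formula.tensor A B))
      (part : G.Vertex → Part) (hp : G.IsSplitting w part)
      (hw : G.InZone part w Zone.opposite) :
      RawMove G (G.splitTensor part w hw A B)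
  /-- On an output `A ⊕ B`: change the formula into `A`. -/
  | plusLeft (w : G.Vertex) (A B : Formula) (h : G.label G.token w = some (Formula.plus A B)) :
      RawMove G ((G.setEdge G.token w A).passTo w)
  /-- On an output `A ⊕ B`: change the formula into `B`. -/
  | plusRight (w : G.Vertex) (A B : Formula) (h : G.label G.token w = some (Formula.plus A B)) :
      RawMove G ((G.setEdge G.token w B).passTo w)
  /-- On an output `?A^⊥`: for any `n`, replace it by an edge labelled `⊗ⁿ A` in the other
  direction (`n`-ary dereliction). -/
  | whyNot (w : G.Vertex) (A : Formula)
      (h : G.label G.token w = some (Formula.whyNot A.dual)) (n : ℕ) :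
      RawMove G ((G.setEdge w G.token (Formula.tensorPow n A)).passTo w)

end Diagram

/-- Positions of the game. -/
def Position : Type 1 := {G : Diagram // G.IsPosition}

/-- The graph of positions and moves; positions are considered up to isomorphism. -/
def Move (U U' : Position) : Prop :=
  ∃ H : Diagram, U.1.RawMove H ∧ Nonempty (H.Iso U'.1)

/-- A play from `U`: a directed path, finite or infinite, starting at `U` in the graph of
positions and moves. It has `length` moves; the values of `pos k` for `k > length` are
irrelevant. -/
structure Play (U : Position) where
  length : ℕ∞
  pos : ℕ → Position
  start : pos 0 = U
  move : ∀ k : ℕ, (k : ℕ∞) < length → Move (pos k) (pos (k + 1))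

end LLTN

/-!
Root a position at the vertex holding the token: every move then replaces one branch `(F, m)` at the
root by at most two branches, whose labels come from `F`, and moves the root to the vertex at which
`m` was attached. The other branches at the old root are left behind, distributed over the new
branches. For termination nothing is lost by letting each new branch carry its own copy of any part
of them.

These moves on trees terminate by reducibility in the style of Tait and Girard: branches `m` are
reducible at `F` if, after any move made along an edge labelled `F` above `m`, reducible branches
lead to a terminating tree. If all branches of a tree are reducible, then the tree terminates: after
a move to a reducible branch it suffices that what is left behind be reducible at the new labels,
and the next move there puts labels of smaller rank in place of the first one, so the multiset of
the ranks at the root decreases in the Dershowitz–Manna order. The ranks are ordinals because `!A`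
must dominate all tensor powers of `A`. By induction on the tree, all branches are reducible.

The result of a tensor move is a covering of the original position away from the edges between the
active and the passive vertices, so that the branches of its unfolding are branches of the original
unfolding.
-/

namespace LLTN

namespace Formula

theorem dual_dual (A : Formula) : A.dual.dual = A := by
  induction A <;> simp_all only [dual]

theorem isPositive_dual (A : Formula) : A.dual.isPositive = !A.isPositive := by
  cases A <;> rfl

/-- An ordinal measure of formulae that is invariant under duality. The connectives `?` and `!`
add `ω`, so that `!A` dominates all tensor powers of `A`. -/
noncomputable def rank : Formula → Ordinal.{0}
  | zero | one | top | bot => 0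
  | tensor A B | plus A B | par A B | amp A B => max A.rank B.rank + 1
  | whyNot A | ofCourse A => A.rank + Ordinal.omega0

theorem rank_dual (A : Formula) : A.dual.rank = A.rank := by
  induction A <;> simp_all only [dual, rank]

theorem rank_tensorPow_le (n : ℕ) (A : Formula) : (tensorPow n A).rank ≤ A.rank + n := by
  induction n with
  | zero => simp [tensorPow, rank]
  | succ n ih =>
    rw [tensorPow, rank, Nat.cast_succ, ← add_assoc]
    gcongr
    exact max_le ih le_self_add

theorem rank_tensorPow_lt_rank_ofCourse (n : ℕ) (A : Formula) :
    (tensorPow n A).rank < (ofCourse A).rank :=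
  (rank_tensorPow_le n A).trans_lt <| by rw [rank]; gcongr; exact Ordinal.natCast_lt_omega0 n

/-- The possible effects of a move along an edge labelled `F`, where labels are read from the
passive vertex: `L ∈ F.reducts` if the edge may be replaced by edges labelled by the members of
`L`. If `F` is positive then only the negative move is possible, and it does not change the
edge. -/
def reducts : Formula → Set (List Formula)
  | top => ∅
  | bot => {[]}
  | par A B => {[A, B]}
  | amp A B => {[A], [B]}
  | ofCourse A => Set.range fun n => [tensorPow n A]
  | F => {[F]}

theorem reducts_of_isPositive {F : Formula} (hF : F.isPositive = true) : F.reducts = {[F]} := by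
  cases F <;> first | rfl | exact absurd hF Bool.false_ne_true

theorem rank_lt_of_mem_reducts {F G : Formula} {L : List Formula} (hF : F.isPositive = false)
    (hL : L ∈ F.reducts) (hG : G ∈ L) : G.rank < F.rank := by
  cases F with
  | zero | one | tensor | plus | whyNot => exact absurd hF.symm Bool.false_ne_true
  | top => exact absurd hL (Set.notMem_empty _)
  | bot =>
    obtain rfl : L = [] := hL
    exact absurd hG List.not_mem_nil
  | par A B =>
    obtain rfl : L = [A, B] := hL
    rcases List.mem_pair.1 hG with rfl | rfl <;> simp [rank, Order.lt_add_one_iff]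
  | amp A B =>
    rcases hL with rfl | rfl <;> obtain rfl := List.mem_singleton.1 hG <;>
      simp [rank, Order.lt_add_one_iff]
  | ofCourse A =>
    obtain ⟨n, rfl⟩ := hL
    obtain rfl := List.mem_singleton.1 hG
    exact rank_tensorPow_lt_rank_ofCourse n A

theorem eq_or_rank_lt_of_mem_reducts {F G : Formula} {L : List Formula} (hL : L ∈ F.reducts)
    (hG : G ∈ L) : F.isPositive = true ∧ G = F ∨ G.rank < F.rank := by
  cases hF : F.isPositive with
  | false => exact .inr (rank_lt_of_mem_reducts hF hL hG)
  | true =>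
    rw [reducts_of_isPositive hF, Set.mem_singleton_iff] at hL
    exact .inl ⟨rfl, List.mem_singleton.1 (hL ▸ hG)⟩

theorem rank_lt_of_mem_reducts_of_mem_reducts {F G H : Formula} {L L' : List Formula}
    (hL : L ∈ F.dual.reducts) (hG : G ∈ L) (hL' : L' ∈ G.dual.reducts) (hH : H ∈ L') :
    H.rank < F.rank := by
  rcases eq_or_rank_lt_of_mem_reducts hL hG with ⟨hF, rfl⟩ | hGF
  · rw [dual_dual] at hL'
    exact rank_lt_of_mem_reducts (by simpa [isPositive_dual] using hF) hL' hH
  · calc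
      H.rank ≤ G.dual.rank := by
        rcases eq_or_rank_lt_of_mem_reducts hL' hH with ⟨-, rfl⟩ | hHG
        exacts [le_rfl, hHG.le]
      _ = G.rank := rank_dual G
      _ < F.dual.rank := hGF
      _ = F.rank := rank_dual F

end Formula

/-- Finite rooted trees whose edges are labelled by formulae, read from the parent. A position is
represented by the tree obtained by rooting it at the vertex that holds the token. -/
inductive RootedTree : Type
  | node : List (Formula × RootedTree) → RootedTree

/-- The branches at the root of a tree, each of them with the label of its edge. They stand for
the tree itself, but their order is only meant up to permutation. -/
abbrev Branches : Type := List (Formula × RootedTree)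

/-- The branches at the root of a tree. -/
def RootedTree.branches : RootedTree → Branches
  | node l => l

/-- The moves on trees rooted at the vertex holding the token. This is more liberal than the game:
on whatever edge the token passes, each of the edges which replace it may carry its own copy of any
part of the branches left behind. -/
inductive Step : Branches → Branches → Prop
  | mk {l m r Y : Branches} (F : Formula) (perm : l.Perm ((F, .node m) :: r))
      (labels : Y.map Prod.fst ∈ F.dual.reducts) (subperm : ∀ e ∈ Y, e.2.branches.Subperm r) :
      Step l (Y ++ m)

/-- All sequences of moves from `l` are finite. -/
def Terminates (l : Branches) : Prop := Acc (flip Step) l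

/-- The reducibility predicate: `Reducible F m` says that a tree with branches `m` terminates
once the token reaches its root through an additional edge labelled `F`, whatever move was made on
that edge, provided that the trees at the other end are themselves reducible. -/
def Reducible (F : Formula) (m : Branches) : Prop :=
  ∀ Y : Branches, (hY : Y.map Prod.fst ∈ F.reducts) →
    (∀ e ∈ Y, Reducible e.1.dual e.2.branches) → Terminates (Y ++ m)
termination_by (F.rank, if F.isPositive then 1 else 0)
decreasing_by
  rename_i he
  rcases Formula.eq_or_rank_lt_of_mem_reducts hY (List.mem_map_of_mem he) with ⟨hF, hEq⟩ | hlt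
  · rw [hEq]
    simp [Prod.lex_def, Formula.rank_dual, Formula.isPositive_dual, hF]
  · exact .left _ _ (by rwa [Formula.rank_dual])

/-- The ranks of the labels at the root of a tree. -/
noncomputable def rootRanks (l : Branches) : Multiset Ordinal.{0} :=
  (l : Multiset (Formula × RootedTree)).map fun e => e.1.rank

theorem rootRanks_append_isDershowitzMannaLT {l r k Y : Branches} {F : Formula} {t : RootedTree}
    (hl : l.Perm ((F, t) :: r)) (hk : k.Subperm r) (hY : ∀ e ∈ Y, e.1.rank < F.rank) :
    (rootRanks (Y ++ k)).IsDershowitzMannaLT (rootRanks l) := by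
  obtain ⟨u, hu⟩ := Multiset.le_iff_exists_add.1 (Multiset.coe_le.2 hk)
  refine ⟨rootRanks k, rootRanks Y, F.rank ::ₘ u.map fun e => e.1.rank, by simp, ?_, ?_, ?_⟩
  · rw [rootRanks, ← Multiset.coe_add, Multiset.map_add, add_comm, rootRanks, rootRanks]
  · rw [rootRanks, Multiset.coe_eq_coe.2 hl, ← Multiset.cons_coe, hu, Multiset.map_cons,
      Multiset.map_add, rootRanks, Multiset.add_cons]
  · intro y hy
    obtain ⟨e, he, rfl⟩ := Multiset.mem_map.1 hy
    exact ⟨F.rank, Multiset.mem_cons_self _ _, hY e he⟩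

theorem terminates_of_forall_reducible (l : Branches)
    (hl : ∀ e ∈ l, Reducible e.1.dual e.2.branches) : Terminates l := by
  have wf := InvImage.wf rootRanks Multiset.wellFounded_isDershowitzMannaLT
  induction l using wf.induction with | _ l ih
  refine ⟨_, ?_⟩
  rintro _ @⟨m, r, Y, F, hperm, hY, hsub⟩
  have hm : Reducible F.dual m := hl (F, .node m) (hperm.symm.subset List.mem_cons_self)
  rw [Reducible] at hm
  refine hm Y hY fun e he => ?_
  rw [Reducible]
  intro Y' hY' hred
  have hrank : ∀ e' ∈ Y', e'.1.rank < F.rank := fun e' he' =>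
    Formula.rank_lt_of_mem_reducts_of_mem_reducts hY (List.mem_map_of_mem he) hY'
      (List.mem_map_of_mem he')
  refine ih _ (rootRanks_append_isDershowitzMannaLT hperm (hsub e he) hrank) ?_
  intro e' he'
  rcases List.mem_append.1 he' with hmem | hmem
  · exact hred e' hmem
  · exact hl e' (hperm.symm.subset (List.mem_cons_of_mem _ ((hsub e he).subset hmem)))

theorem reducible_branches (F : Formula) (t : RootedTree) : Reducible F t.branches := by
  rw [Reducible]
  refine fun Y _ hY => terminates_of_forall_reducible _ fun e he => ?_
  rcases List.mem_append.1 he with he | he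
  · exact hY e he
  · exact reducible_branches e.1.dual e.2
termination_by t
decreasing_by
  obtain ⟨l⟩ := t
  obtain ⟨G, u⟩ := e
  have := List.sizeOf_lt_of_mem he
  simp only [RootedTree.branches, Prod.mk.sizeOf_spec, RootedTree.node.sizeOf_spec] at this ⊢
  omega

theorem terminates (l : Branches) : Terminates l :=
  terminates_of_forall_reducible l fun e _ => reducible_branches e.1.dual e.2

/-- A graph on `V` whose edges are labelled by formulae, where `label x y` is the label of the edge
between `x` and `y` as read from `x`, if there is such an edge. -/
structure View (V : Type*) where
  label : V → V → Option Formula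
  isSome_symm : ∀ {x y}, (label x y).isSome → (label y x).isSome

namespace View

variable {V W : Type*} {N : View V} {N' : View W}

/-- The neighbours of a vertex. -/
def neighborSet (N : View V) (x : V) : Set V := {y | (N.label x y).isSome}

theorem mem_neighborSet {x y : V} : y ∈ N.neighborSet x ↔ (N.label x y).isSome :=
  Iff.rfl

theorem mem_neighborSet_of_label_eq {x y : V} {F : Formula} (h : N.label x y = some F) :
    y ∈ N.neighborSet x :=
  Option.isSome_iff_exists.2 ⟨F, h⟩

theorem mem_neighborSet_comm {x y : V} : y ∈ N.neighborSet x ↔ x ∈ N.neighborSet y :=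
  ⟨N.isSome_symm, N.isSome_symm⟩

/-- `N.Beyond x y z` if there is a walk from `y` to `z` which, continuing a step from `x` to `y`,
never goes back along the edge it has just used. -/
inductive Beyond (N : View V) : V → V → V → Prop
  | self (x y : V) : Beyond N x y y
  | step {x y y' z : V} (mem : y' ∈ N.neighborSet y) (ne : y' ≠ x) (tail : Beyond N y y' z) :
      Beyond N x y z

/-- A graph is a forest if no walk without backtracking returns to its starting point. -/
def IsForest (N : View V) : Prop :=
  ∀ ⦃x y z⦄, y ∈ N.neighborSet x → N.Beyond x y z → z ≠ x

theorem IsForest.ne_and_ne_of_beyond (hN : N.IsForest) {v w y z : V} (hw : w ∈ N.neighborSet v)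
    (hy : y ∈ N.neighborSet v \ {w}) (hz : N.Beyond v y z) : z ≠ v ∧ z ≠ w :=
  ⟨hN hy.1 hz, hN (mem_neighborSet_comm.1 hw) (.step hy.1 hy.2 hz)⟩

/-- `N.Unfolds v T s` if `s` lists the branches at the root `v` of the tree unfolding of `N`, one
for each vertex of `T`; below the root, a branch goes on to all neighbours except its parent. -/
inductive Unfolds (N : View V) : V → Set V → Branches → Prop
  | nil (v : V) : Unfolds N v ∅ []
  | cons {v w : V} {T : Set V} {F : Formula} {m s : Branches} (label : N.label v w = some F)
      (notMem : w ∉ T) (head : Unfolds N w (N.neighborSet w \ {v}) m) (tail : Unfolds N v T s) :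
      Unfolds N v (insert w T) ((F, .node m) :: s)

theorem Unfolds.exists_subperm {v : V} {T T' : Set V} {s : Branches} (h : N.Unfolds v T s)
    (hT : T' ⊆ T) : ∃ s' : Branches, s'.Subperm s ∧ N.Unfolds v T' s' := by
  induction h generalizing T' with
  | nil v =>
    obtain rfl := Set.subset_empty_iff.1 hT
    exact ⟨[], .refl _, .nil v⟩
  | @cons v w T F m s label _ head _ _ ih =>
    by_cases hw : w ∈ T'
    · obtain ⟨s', hs, h'⟩ := ih (Set.sdiff_singleton_subset_iff.2 hT)
      refine ⟨(F, .node m) :: s', (List.subperm_cons _).2 hs, ?_⟩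
      rw [← Set.insert_sdiff_self_of_mem hw]
      exact .cons label (fun h => h.2 rfl) head h'
    · obtain ⟨s', hs, h'⟩ := ih ((Set.subset_insert_iff_of_notMem hw).1 hT)
      exact ⟨s', hs.cons_right _, h'⟩

theorem Unfolds.exists_perm_cons {v w : V} {T : Set V} {F : Formula} {s : Branches}
    (h : N.Unfolds v T s) (hw : w ∈ T) (hF : N.label v w = some F) :
    ∃ m r : Branches, s.Perm ((F, .node m) :: r) ∧ N.Unfolds w (N.neighborSet w \ {v}) m ∧
      N.Unfolds v (T \ {w}) r := by
  induction h with
  | nil => exact absurd hw (Set.notMem_empty _)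
  | @cons v u T G m s label notMem head tail _ ih =>
    obtain rfl | hwu := eq_or_ne w u
    · obtain rfl : F = G := Option.some_injective _ (hF.symm.trans label)
      refine ⟨m, s, .refl _, head, ?_⟩
      rwa [Set.insert_sdiff_self_of_notMem notMem]
    · obtain ⟨m', r, hs, hm', hr⟩ := ih (hw.resolve_left hwu) hF
      refine ⟨m', (G, .node m) :: r, (hs.cons _).trans (.swap _ _ _), hm', ?_⟩
      rw [← Set.insert_sdiff_singleton_comm hwu.symm]
      exact .cons label (fun h => notMem h.1) head hr

theorem exists_unfolds_of_forall {v : V} {T : Set V} (hT : T.Finite) (hTv : T ⊆ N.neighborSet v)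
    (h : ∀ w ∈ T, ∃ m, N.Unfolds w (N.neighborSet w \ {v}) m) : ∃ s, N.Unfolds v T s := by
  induction T, hT using Set.Finite.induction_on with
  | empty => exact ⟨[], .nil v⟩
  | @insert w T hw _ ih =>
    obtain ⟨F, hF⟩ := Option.isSome_iff_exists.1 (hTv (Set.mem_insert w T))
    obtain ⟨m, hm⟩ := h w (Set.mem_insert w T)
    obtain ⟨s, hs⟩ := ih ((Set.subset_insert w T).trans hTv) fun u hu =>
      h u (Set.mem_insert_of_mem w hu)
    exact ⟨_, .cons hF hw hm hs⟩

theorem IsForest.exists_unfolds_of_mem [Finite V] (hN : N.IsForest) {x y : V}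
    (hy : y ∈ N.neighborSet x) : ∃ m, N.Unfolds y (N.neighborSet y \ {x}) m := by
  induction hn : {z | N.Beyond x y z}.ncard using Nat.strong_induction_on generalizing x y with
  | _ n ih
  subst hn
  refine exists_unfolds_of_forall (Set.toFinite _) Set.sdiff_subset fun z hz => ih _ ?_ hz.1 rfl
  refine Set.ncard_lt_ncard ⟨fun u hu => Beyond.step hz.1 hz.2 hu, fun h => ?_⟩
  exact hN hz.1 (h (.self x y)) rfl

theorem IsForest.exists_unfolds [Finite V] (hN : N.IsForest) (v : V) :
    ∃ s, N.Unfolds v (N.neighborSet v) s :=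
  exists_unfolds_of_forall (Set.toFinite _) subset_rfl fun _ hw => hN.exists_unfolds_of_mem hw

/-- `ψ` restricts to a bijection from the neighbours `T'` of `x` onto `T` which is compatible with
the labels read from `x`. -/
structure IsLocalIso (N : View V) (N' : View W) (ψ : W → V) (x : W) (T' : Set W) (T : Set V) :
    Prop where
  bijOn : Set.BijOn ψ T' T
  label_eq : ∀ y ∈ T', N.label (ψ x) (ψ y) = N'.label x y

/-- `ψ` is a covering at `x`: a bijection, compatible with the labels, on the neighbours of `x`. -/
def IsCoveringAt (N : View V) (N' : View W) (ψ : W → V) (x : W) : Prop :=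
  IsLocalIso N N' ψ x (N'.neighborSet x) (N.neighborSet (ψ x))

theorem IsLocalIso.id {N N' : View V} {x : V} {T : Set V}
    (h : ∀ y ∈ T, N.label x y = N'.label x y) : IsLocalIso N N' id x T T :=
  ⟨Set.bijOn_id T, h⟩

theorem isCoveringAt_id {N N' : View V} {x : V} (h : N'.label x = N.label x) :
    IsCoveringAt N N' id x := by
  have hx : N'.neighborSet x = N.neighborSet x := by simp only [neighborSet, h]
  rw [IsCoveringAt, hx]
  exact .id fun y _ => by rw [h]

/-- The hypotheses only concern the vertices that the unfolding visits, because the result of a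
tensor move does not cover the original position at the ends of the new edges. -/
theorem Unfolds.lift {ψ : W → V} {v : V} {x : W} {T : Set V} {T' : Set W} {s : Branches}
    (h : N.Unfolds v T s) (hx : ψ x = v) (hloc : IsLocalIso N N' ψ x T' T)
    (hcov : ∀ w ∈ T, ∀ y, N.Beyond v w (ψ y) → IsCoveringAt N N' ψ y) : N'.Unfolds x T' s := by
  induction h generalizing x T' with
  | nil =>
    obtain rfl : T' = ∅ := Set.subset_empty_iff.1 fun y hy => hloc.bijOn.mapsTo hy
    exact .nil x
  | @cons v w T F m s label notMem _ _ ihHead ihTail =>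
    obtain ⟨y, hy, rfl⟩ := hloc.bijOn.surjOn (Set.mem_insert w T)
    have hlabel : N'.label x y = some F := by rw [← hloc.label_eq y hy, hx, label]
    have hxy : x ∈ N'.neighborSet y :=
      mem_neighborSet_comm.1 (mem_neighborSet_of_label_eq hlabel)
    have hcovy : IsCoveringAt N N' ψ y := hcov _ (Set.mem_insert _ T) y (.self _ _)
    have hhead : N'.Unfolds y (N'.neighborSet y \ {x}) m :=
      ihHead rfl ⟨hx ▸ hcovy.bijOn.sdiff_singleton hxy, fun z hz => hcovy.label_eq z hz.1⟩
        fun z hz y' hy' => hcov _ (Set.mem_insert _ T) y' (.step hz.1 hz.2 hy')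
    have htail : N'.Unfolds x (T' \ {y}) s := by
      have hbij := hloc.bijOn.sdiff_singleton hy
      rw [Set.insert_sdiff_self_of_notMem notMem] at hbij
      exact ihTail hx ⟨hbij, fun z hz => hloc.label_eq z hz.1⟩ fun w' hw' =>
        hcov w' (Set.mem_insert_of_mem _ hw')
    rw [← Set.insert_sdiff_self_of_mem hy]
    exact .cons hlabel (fun h => h.2 rfl) hhead htail

theorem Unfolds.of_equiv (e : V ≃ W) (he : ∀ x y, N'.label (e x) (e y) = N.label x y) {v : V}
    {s : Branches} (h : N.Unfolds v (N.neighborSet v) s) :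
    N'.Unfolds (e v) (N'.neighborSet (e v)) s := by
  have he' : ∀ x y, N.label (e.symm x) (e.symm y) = N'.label x y := fun x y => by simp [← he]
  have hcov : ∀ y, IsCoveringAt N N' e.symm y := fun y =>
    ⟨e.symm.bijOn fun z => by rw [mem_neighborSet, mem_neighborSet, he'],
      fun z _ => he' y z⟩
  have hv := hcov (e v)
  rw [IsCoveringAt, e.symm_apply_apply] at hv
  exact h.lift (e.symm_apply_apply v) hv fun _ _ y _ => hcov y

/-- `N` and `N'` have the same edges, with the same labels, except possibly for an edge between `v`
and `w`. -/
def AgreeOffEdge (N N' : View V) (v w : V) : Prop :=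
  ∀ x y, ¬(x = v ∧ y = w) → ¬(x = w ∧ y = v) → N'.label x y = N.label x y

theorem AgreeOffEdge.symm {N N' : View V} {v w : V} (h : AgreeOffEdge N N' v w) :
    AgreeOffEdge N N' w v :=
  fun x y hxy hyx => h x y hyx hxy

theorem AgreeOffEdge.neighborSet_sdiff {N N' : View V} {v w : V} (h : AgreeOffEdge N N' v w)
    (hvw : v ≠ w) : N'.neighborSet v \ {w} = N.neighborSet v \ {w} := by
  ext y
  refine and_congr_left fun hy => ?_
  rw [mem_neighborSet, mem_neighborSet,
    h v y (fun h => hy h.2) (fun h => hvw h.1)]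

theorem Unfolds.of_agreeOffEdge {N N' : View V} {v w : V} {s : Branches} (hN : N.IsForest)
    (hw : w ∈ N.neighborSet v) (hN' : AgreeOffEdge N N' v w)
    (h : N.Unfolds v (N.neighborSet v \ {w}) s) : N'.Unfolds v (N'.neighborSet v \ {w}) s := by
  have hvw : v ≠ w := (hN hw (.self _ _)).symm
  rw [hN'.neighborSet_sdiff hvw]
  refine h.lift (ψ := id) rfl (.id fun y hy => ?_) fun y hy z hz => isCoveringAt_id ?_
  · exact (hN' v y (fun h => hy.2 h.2) fun h => hvw h.1).symm
  · obtain ⟨hzv, hzw⟩ := hN.ne_and_ne_of_beyond hw hy hz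
    exact funext fun u => hN' z u (fun h => hzv h.1) fun h => hzw h.1

theorem Unfolds.exists_reroot_of_agreeOffEdge {N N' : View V} {v w : V} {F G : Formula}
    {s : Branches} (hN : N.IsForest) (h : N.Unfolds v (N.neighborSet v) s)
    (hF : N.label v w = some F) (hG : N'.label w v = some G) (hN' : AgreeOffEdge N N' v w) :
    ∃ m r : Branches, s.Perm ((F, .node m) :: r) ∧
      N'.Unfolds w (N'.neighborSet w) ((G, .node r) :: m) := by
  have hw := mem_neighborSet_of_label_eq hF
  obtain ⟨m, r, hs, hm, hr⟩ := h.exists_perm_cons hw hF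
  refine ⟨m, r, hs, ?_⟩
  rw [← Set.insert_sdiff_self_of_mem (mem_neighborSet_of_label_eq hG)]
  exact .cons hG (fun h => h.2 rfl) (hr.of_agreeOffEdge hN hw hN')
    (hm.of_agreeOffEdge hN (mem_neighborSet_comm.1 hw) hN'.symm)

end View

namespace Diagram

open Formula

/-- The labels of a diagram, read from both ends of each edge. -/
def view (G : Diagram) : View G.Vertex where
  label x y := (G.label x y).or ((G.label y x).map dual)
  isSome_symm h := by simpa [or_comm] using h

theorem view_label_of_label_eq {G : Diagram} {x y : G.Vertex} {A : Formula}
    (h : G.label x y = some A) : G.view.label x y = some A := by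
  simp [view, h]

theorem IsPosition.view_label_of_label_swap_eq {G : Diagram} (hG : G.IsPosition) {x y : G.Vertex}
    {A : Formula} (h : G.label y x = some A) : G.view.label x y = some A.dual := by
  simp [view, h, hG.oneWay y x (by simp [h])]

theorem IsPosition.adj_iff {G : Diagram} (hG : G.IsPosition) {x y : G.Vertex} :
    G.skeleton.Adj x y ↔ y ∈ G.view.neighborSet x := by
  rw [skeleton, SimpleGraph.fromRel_adj]
  constructor
  · rintro ⟨-, h⟩
    simpa [View.mem_neighborSet, view] using h
  · intro h
    have h' : (G.label x y).isSome ∨ (G.label y x).isSome := by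
      simpa [View.mem_neighborSet, view] using h
    refine ⟨?_, h'⟩
    rintro rfl
    have hx : (G.label x x).isSome := h'.elim id id
    simp [hG.oneWay x x hx] at hx

theorem IsPosition.exists_isPath_cons_of_beyond {G : Diagram} (hG : G.IsPosition)
    {x y z : G.Vertex} (h : G.view.Beyond x y z) (hxy : G.skeleton.Adj x y) :
    ∃ p : G.skeleton.Walk y z, (SimpleGraph.Walk.cons hxy p).IsPath := by
  induction h with
  | self => exact ⟨.nil, by simpa using hxy.ne⟩
  | @step x y y' z mem ne _ ih =>
    have hyy' := hG.adj_iff.2 mem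
    obtain ⟨p, hp⟩ := ih hyy'
    refine ⟨.cons hyy' p, ?_⟩
    rw [hG.tree.isAcyclic.isPath_iff_isChain] at hp ⊢
    simp only [SimpleGraph.Walk.edges_cons] at hp ⊢
    exact List.isChain_cons_cons.2 ⟨fun h => ne (by simpa [hxy.ne, eq_comm] using h), hp⟩

theorem IsPosition.isForest_view {G : Diagram} (hG : G.IsPosition) : G.view.IsForest := by
  rintro x y z hy hz rfl
  obtain ⟨p, hp⟩ := hG.exists_isPath_cons_of_beyond hz (hG.adj_iff.2 hy)
  exact ((SimpleGraph.Walk.cons_isPath_iff _ _).1 hp).2 p.end_mem_support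

open Classical in
theorem view_setEdge_label {G : Diagram} {a b : G.Vertex} (hab : a ≠ b) (F : Formula)
    (x y : G.Vertex) :
    (G.setEdge a b F).view.label x y =
      if x = a ∧ y = b then some F
      else if x = b ∧ y = a then some F.dual
      else G.view.label x y := by
  unfold view setEdge
  by_cases h₁ : x = a ∧ y = b
  · obtain ⟨rfl, rfl⟩ := h₁
    cases hF : F.isPositive <;> simp [hab, hab.symm, dual_dual]
  by_cases h₂ : x = b ∧ y = a
  · obtain ⟨rfl, rfl⟩ := h₂
    cases hF : F.isPositive <;> simp [hab, hab.symm]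
  have h₁' : ¬(y = b ∧ x = a) := fun h => h₁ h.symm
  have h₂' : ¬(y = a ∧ x = b) := fun h => h₂ h.symm
  simp [h₁, h₂, h₁', h₂']

theorem agreeOffEdge_view_setEdge {G : Diagram} {a b : G.Vertex} (hab : a ≠ b) (F : Formula) :
    View.AgreeOffEdge G.view (G.setEdge a b F).view a b := fun x y h₁ h₂ => by
  classical rw [view_setEdge_label hab, if_neg h₁, if_neg h₂]

theorem IsPosition.unfolds_view_deleteActive {G : Diagram} (hG : G.IsPosition) {w : G.Vertex}
    (sole : ∀ x, G.skeleton.Adj G.token x → x = w) (hw : w ≠ G.token) {m : Branches}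
    (h : G.view.Unfolds w (G.view.neighborSet w \ {G.token}) m) :
    (G.deleteActive w hw).view.Unfolds ⟨w, hw⟩
      ((G.deleteActive w hw).view.neighborSet ⟨w, hw⟩) m := by
  have hloc : ∀ y : {x // x ≠ G.token}, View.IsLocalIso G.view (G.deleteActive w hw).view
      Subtype.val y ((G.deleteActive w hw).view.neighborSet y)
      (G.view.neighborSet y.1 \ {G.token}) := fun y =>
    ⟨⟨fun z hz => ⟨hz, z.2⟩, Subtype.val_injective.injOn, fun z hz => ⟨⟨z, hz.2⟩, hz.1, rfl⟩⟩,
      fun _ _ => rfl⟩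
  refine h.lift (ψ := Subtype.val) rfl (hloc ⟨w, hw⟩) fun z hz y hy => ?_
  have hyw : y.1 ≠ w := hG.isForest_view hz.1 hy
  have hyv : G.token ∉ G.view.neighborSet y.1 := fun h =>
    hyw (sole _ (hG.adj_iff.2 (View.mem_neighborSet_comm.1 h)))
  have hy := hloc y
  rwa [Set.sdiff_singleton_eq_self hyv] at hy

/-- The vertices of the result of a tensor move: the pairs of a vertex and a zone in which it has a
copy. -/
abbrev Copies (G : Diagram) (part : G.Vertex → Part) : Type :=
  {p : G.Vertex × Zone // G.InZone part p.1 p.2}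

/-- The edges of the result of a tensor move, read from both ends. -/
noncomputable def splitView (G : Diagram) (part : G.Vertex → Part) (w : G.Vertex)
    (hw : G.InZone part w .opposite) (A B : Formula) : View (G.Copies part) :=
  (G.splitTensor part w hw A B).view

section Tensor

variable {G : Diagram} {part : G.Vertex → Part} {w : G.Vertex} {A B : Formula}

open Classical in
theorem view_zones_label (hw : G.InZone part w .opposite) (p q : (G.zones part w hw).Vertex) :
    (G.zones part w hw).view.label p q =
      if p.1.2 = q.1.2 then G.view.label p.1.1 q.1.1 else none := by
  unfold view zones
  by_cases h : p.1.2 = q.1.2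
  · simp [h]
  · simp [h, Ne.symm h]

open Classical in
theorem splitView_label (hw : G.InZone part w .opposite) (p q : G.Copies part) :
    (G.splitView part w hw A B).label p q =
      if p.1 = (G.token, .second) ∧ q.1 = (w, .opposite) then some B
      else if p.1 = (w, .opposite) ∧ q.1 = (G.token, .second) then some B.dual
      else if p.1 = (G.token, .first) ∧ q.1 = (w, .opposite) then some A
      else if p.1 = (w, .opposite) ∧ q.1 = (G.token, .first) then some A.dual
      else if p.1.2 = q.1.2 then G.view.label p.1.1 q.1.1 else none := by
  have ne : ∀ ζ, ζ ≠ Zone.opposite → ∀ h, (⟨(G.token, ζ), h⟩ : (G.zones part w hw).Vertex) ≠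
      ⟨(w, .opposite), hw⟩ := fun ζ hζ h e => hζ (congrArg (fun p => p.1.2) e)
  refine (view_setEdge_label (G := (G.zones part w hw).setEdge ⟨(G.token, .first), .inl rfl⟩
    ⟨(w, .opposite), hw⟩ A) (ne .second (by simp) _) B p q).trans ?_
  refine if_congr (and_congr Subtype.ext_iff Subtype.ext_iff) rfl
    (if_congr (and_congr Subtype.ext_iff Subtype.ext_iff) rfl ?_)
  refine (view_setEdge_label (G := G.zones part w hw) (ne .first (by simp) _) A p q).trans ?_
  exact if_congr (and_congr Subtype.ext_iff Subtype.ext_iff) rfl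
    (if_congr (and_congr Subtype.ext_iff Subtype.ext_iff) rfl (view_zones_label hw p q))

theorem splitView_label_of_zone_eq (hw : G.InZone part w .opposite) {p q : G.Copies part}
    (h : p.1.2 = q.1.2) :
    (G.splitView part w hw A B).label p q = G.view.label p.1.1 q.1.1 := by
  obtain ⟨⟨x, ζ⟩, hx⟩ := p
  obtain ⟨⟨y, ζ'⟩, hy⟩ := q
  obtain rfl : ζ = ζ' := h
  rw [splitView_label]
  cases ζ <;> simp

theorem mem_neighborSet_splitView (hw : G.InZone part w .opposite) {p q : G.Copies part}
    (h : q ∈ (G.splitView part w hw A B).neighborSet p) :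
    q.1.2 = p.1.2 ∨ s(p.1, q.1) = s((G.token, .first), (w, .opposite)) ∨
      s(p.1, q.1) = s((G.token, .second), (w, .opposite)) := by
  rw [View.mem_neighborSet, splitView_label] at h
  split_ifs at h with h₁ h₂ h₃ h₄ h₅
  · simp [h₁]
  · simp [h₂]
  · simp [h₃]
  · simp [h₄]
  · exact .inl h₅.symm
  · simp at h

theorem isLocalIso_splitView (hw : G.InZone part w .opposite) (p : G.Copies part) :
    View.IsLocalIso G.view (G.splitView part w hw A B) (fun q => q.1.1) p
      {q ∈ (G.splitView part w hw A B).neighborSet p | q.1.2 = p.1.2}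
      {z ∈ G.view.neighborSet p.1.1 | G.InZone part z p.1.2} := by
  refine ⟨⟨fun q ⟨hq, hpq⟩ => ⟨?_, hpq ▸ q.2⟩, fun q hq q' hq' h => ?_, fun z ⟨hz, hzone⟩ => ?_⟩,
    fun q hq => (splitView_label_of_zone_eq hw hq.2.symm).symm⟩
  · rwa [View.mem_neighborSet, splitView_label_of_zone_eq hw hpq.symm] at hq
  · exact Subtype.ext (Prod.ext h (hq.2.trans hq'.2.symm))
  · refine ⟨⟨(z, p.1.2), hzone⟩, ⟨?_, rfl⟩, rfl⟩
    have hlabel := splitView_label_of_zone_eq (A := A) (B := B) hw (p := p)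
      (q := ⟨(z, p.1.2), hzone⟩) rfl
    rwa [View.mem_neighborSet, hlabel]

theorem inZone_of_adj (hp : G.IsSplitting w part) {x y : G.Vertex} {ζ : Zone}
    (hxy : G.skeleton.Adj x y) (hxv : x ≠ G.token) (hxw : x ≠ w) (hx : G.InZone part x ζ) :
    G.InZone part y ζ := by
  obtain rfl | hyv := eq_or_ne y G.token
  · have hdelta := (hp.delta_iff x hxy.symm).not.2 hxw
    cases ζ <;> simp_all [InZone]
  · have hpart := hp.closed x y hxv hyv hxy
    cases ζ <;> simp_all [InZone]

theorem isCoveringAt_splitView (hG : G.IsPosition) (hp : G.IsSplitting w part)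
    (hw : G.InZone part w .opposite) {p : G.Copies part} (hpv : p.1.1 ≠ G.token)
    (hpw : p.1.1 ≠ w) :
    View.IsCoveringAt G.view (G.splitView part w hw A B) (fun q => q.1.1) p := by
  have hloc := isLocalIso_splitView (A := A) (B := B) hw p
  rwa [Set.sep_eq_self_iff_mem_true.2 fun q hq => ?_,
    Set.sep_eq_self_iff_mem_true.2 fun z hz => inZone_of_adj hp (hG.adj_iff.2 hz) hpv hpw p.2]
    at hloc
  rcases mem_neighborSet_splitView hw hq with h | h | h
  · exact h
  all_goals rcases Sym2.eq_iff.1 h with ⟨h, -⟩ | ⟨h, -⟩ <;> simp [h] at hpv hpw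

/-- At the three vertices where edges have been added, the other edges unfold as in `G`. -/
theorem unfolds_splitView (hG : G.IsPosition) (hp : G.IsSplitting w part)
    (hw : G.InZone part w .opposite) (hwv : w ∈ G.view.neighborSet G.token) {p : G.Copies part}
    {u : G.Vertex} (hu : s(p.1.1, u) = s(G.token, w)) (huzone : ¬G.InZone part u p.1.2)
    {s : Branches}
    (h : G.view.Unfolds p.1.1 {z ∈ G.view.neighborSet p.1.1 | G.InZone part z p.1.2} s) :
    (G.splitView part w hw A B).Unfolds p
      {q ∈ (G.splitView part w hw A B).neighborSet p | q.1.2 = p.1.2} s := by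
  refine h.lift rfl (isLocalIso_splitView hw p) fun z hz q hq => ?_
  have hup : u ∈ G.view.neighborSet p.1.1 := by
    rcases Sym2.eq_iff.1 hu with ⟨hpv, rfl⟩ | ⟨hpw, rfl⟩
    exacts [hpv ▸ hwv, hpw ▸ View.mem_neighborSet_comm.1 hwv]
  obtain ⟨hqp, hqu⟩ := hG.isForest_view.ne_and_ne_of_beyond hup
    ⟨hz.1, fun hzu => huzone (hzu ▸ hz.2)⟩ hq
  rcases Sym2.eq_iff.1 hu with ⟨hpv, rfl⟩ | ⟨hpw, rfl⟩
  exacts [isCoveringAt_splitView hG hp hw (hpv ▸ hqp) hqu,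
    isCoveringAt_splitView hG hp hw hqu (hpw ▸ hqp)]

theorem neighborSet_splitView_sdiff (hw : G.InZone part w .opposite) {ζ : Zone}
    (hζ : ζ ≠ .opposite) (hv : G.InZone part G.token ζ) :
    (G.splitView part w hw A B).neighborSet ⟨(G.token, ζ), hv⟩ \ {⟨(w, .opposite), hw⟩} =
      {q ∈ (G.splitView part w hw A B).neighborSet ⟨(G.token, ζ), hv⟩ | q.1.2 = ζ} := by
  ext q
  refine and_congr_right fun hq => ⟨fun hqw => ?_, fun hqζ hqw => hζ ?_⟩
  · have hqw' : q.1 ≠ (w, .opposite) := fun h => hqw (Subtype.ext h)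
    simpa [hqw', hζ] using mem_neighborSet_splitView hw hq
  · exact hqζ.symm.trans (congrArg (fun p => p.1.2) hqw)

theorem neighborSet_splitView_passive (hw : G.InZone part w .opposite) :
    (G.splitView part w hw A B).neighborSet ⟨(w, .opposite), hw⟩ =
      insert ⟨(G.token, .first), .inl rfl⟩ (insert ⟨(G.token, .second), .inl rfl⟩
        {q ∈ (G.splitView part w hw A B).neighborSet ⟨(w, .opposite), hw⟩ |
          q.1.2 = .opposite}) := by
  ext q
  simp only [Set.mem_insert_iff, Set.mem_sep_iff, Subtype.ext_iff]
  constructor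
  · intro hq
    have := mem_neighborSet_splitView hw hq
    simp only [Sym2.eq_iff] at this
    grind
  · rintro (h | h | h)
    · simp [View.mem_neighborSet, splitView_label, h]
    · simp [View.mem_neighborSet, splitView_label, h]
    · exact h.1

theorem exists_unfolds_splitView_active (hG : G.IsPosition) (hp : G.IsSplitting w part)
    (hw : G.InZone part w .opposite) (hwv : w ∈ G.view.neighborSet G.token) {ζ : Zone}
    (hζ : ζ ≠ .opposite) (hv : G.InZone part G.token ζ) {r : Branches}
    (h : G.view.Unfolds G.token (G.view.neighborSet G.token \ {w}) r) :
    ∃ s : Branches, s.Subperm r ∧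
      (G.splitView part w hw A B).Unfolds ⟨(G.token, ζ), hv⟩
        ((G.splitView part w hw A B).neighborSet ⟨(G.token, ζ), hv⟩ \ {⟨(w, .opposite), hw⟩})
        s := by
  have hwζ : ¬G.InZone part w ζ := by
    have := hw
    cases ζ <;> simp_all [InZone]
  obtain ⟨s, hs, hu⟩ := h.exists_subperm (T' := {z ∈ G.view.neighborSet G.token |
    G.InZone part z ζ}) fun z hz => ⟨hz.1, fun hzw => hwζ (hzw ▸ hz.2)⟩
  refine ⟨s, hs, ?_⟩
  rw [neighborSet_splitView_sdiff hw hζ hv]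
  exact unfolds_splitView hG hp hw hwv (p := ⟨(G.token, ζ), hv⟩) rfl hwζ hu

theorem unfolds_splitView_passive (hG : G.IsPosition) (hp : G.IsSplitting w part)
    (hw : G.InZone part w .opposite) (hwv : w ∈ G.view.neighborSet G.token) {m : Branches}
    (h : G.view.Unfolds w (G.view.neighborSet w \ {G.token}) m) :
    (G.splitView part w hw A B).Unfolds ⟨(w, .opposite), hw⟩
      {q ∈ (G.splitView part w hw A B).neighborSet ⟨(w, .opposite), hw⟩ | q.1.2 = .opposite}
      m := by
  refine unfolds_splitView hG hp hw hwv (p := ⟨(w, .opposite), hw⟩) (u := G.token) Sym2.eq_swap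
    (fun h => h.1 rfl) ?_
  convert h using 1
  ext z
  refine and_congr_right fun hz => ⟨fun h => h.1, fun hzv => ⟨hzv, ?_⟩⟩
  rw [← hp.closed w z hw.1 hzv (hG.adj_iff.2 hz), hw.2]

theorem exists_unfolds_splitView (hG : G.IsPosition) (hp : G.IsSplitting w part)
    (hw : G.InZone part w .opposite) {F : Formula} {s : Branches}
    (h : G.view.Unfolds G.token (G.view.neighborSet G.token) s)
    (hF : G.view.label G.token w = some F) :
    ∃ m r s₁ s₂ : Branches, s.Perm ((F, .node m) :: r) ∧ s₁.Subperm r ∧ s₂.Subperm r ∧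
      (G.splitView part w hw A B).Unfolds ⟨(w, .opposite), hw⟩
        ((G.splitView part w hw A B).neighborSet ⟨(w, .opposite), hw⟩)
        ((A.dual, .node s₁) :: (B.dual, .node s₂) :: m) := by
  have hwv := View.mem_neighborSet_of_label_eq hF
  obtain ⟨m, r, hs, hm, hr⟩ := h.exists_perm_cons hwv hF
  obtain ⟨s₁, hs₁, h₁⟩ := exists_unfolds_splitView_active (A := A) (B := B) hG hp hw hwv
    (ζ := .first) (by simp) (.inl rfl) hr
  obtain ⟨s₂, hs₂, h₂⟩ := exists_unfolds_splitView_active (A := A) (B := B) hG hp hw hwv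
    (ζ := .second) (by simp) (.inl rfl) hr
  refine ⟨m, r, s₁, s₂, hs, hs₁, hs₂, ?_⟩
  rw [neighborSet_splitView_passive]
  refine .cons ?_ ?_ h₁ (.cons ?_ ?_ h₂ (unfolds_splitView_passive hG hp hw hwv hm))
  · simp [splitView_label]
  · rintro (h | h)
    · cases congrArg (fun p => p.1.2) h
    · cases h.2
  · simp [splitView_label]
  · simp

theorem exists_step_splitTensor (hG : G.IsPosition) (hp : G.IsSplitting w part)
    (hw : G.InZone part w .opposite) (h : G.label G.token w = some (.tensor A B)) {s : Branches}
    (hs : G.view.Unfolds G.token (G.view.neighborSet G.token) s) :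
    ∃ s', Step s s' ∧ (G.splitView part w hw A B).Unfolds ⟨(w, .opposite), hw⟩
      ((G.splitView part w hw A B).neighborSet ⟨(w, .opposite), hw⟩) s' := by
  obtain ⟨m, r, s₁, s₂, hmr, hs₁, hs₂, hu⟩ :=
    exists_unfolds_splitView hG hp hw hs (view_label_of_label_eq h)
  refine ⟨_, .mk (Y := [(A.dual, .node s₁), (B.dual, .node s₂)]) _ hmr rfl ?_, hu⟩
  simpa [RootedTree.branches] using ⟨hs₁, hs₂⟩

end Tensor

variable {G : Diagram} {w : G.Vertex} {s : Branches}

theorem exists_step_of_agreeOffEdge {N' : View G.Vertex} {F E : Formula} (hG : G.IsPosition)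
    (hs : G.view.Unfolds G.token (G.view.neighborSet G.token) s)
    (hF : G.view.label G.token w = some F) (hE : N'.label w G.token = some E)
    (hN' : View.AgreeOffEdge G.view N' G.token w) (hFE : [E] ∈ F.dual.reducts) :
    ∃ s', Step s s' ∧ N'.Unfolds w (N'.neighborSet w) s' := by
  obtain ⟨m, r, hmr, hu⟩ := hs.exists_reroot_of_agreeOffEdge hG.isForest_view hF hE hN'
  exact ⟨_, .mk (Y := [(E, .node r)]) F hmr hFE
    (by simp [RootedTree.branches, List.Subperm.refl]), hu⟩

theorem exists_step_passTo (hG : G.IsPosition) {A : Formula} (h : G.label w G.token = some A)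
    (hs : G.view.Unfolds G.token (G.view.neighborSet G.token) s) :
    ∃ s', Step s s' ∧ G.view.Unfolds w (G.view.neighborSet w) s' := by
  refine exists_step_of_agreeOffEdge hG hs (hG.view_label_of_label_swap_eq h)
    (view_label_of_label_eq h) (fun _ _ _ _ => rfl) ?_
  rw [dual_dual, reducts_of_isPositive (hG.normal _ _ _ h)]
  exact Set.mem_singleton _

theorem exists_step_deleteActive (hG : G.IsPosition) (h : G.label G.token w = some .one)
    (sole : ∀ x, G.skeleton.Adj G.token x → x = w) (hw : w ≠ G.token)
    (hs : G.view.Unfolds G.token (G.view.neighborSet G.token) s) :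
    ∃ s', Step s s' ∧ (G.deleteActive w hw).view.Unfolds ⟨w, hw⟩
      ((G.deleteActive w hw).view.neighborSet ⟨w, hw⟩) s' := by
  have hlabel := view_label_of_label_eq h
  obtain ⟨m, r, hmr, hm, -⟩ :=
    hs.exists_perm_cons (View.mem_neighborSet_of_label_eq hlabel) hlabel
  exact ⟨m, .mk (Y := []) _ hmr rfl (by simp), hG.unfolds_view_deleteActive sole hw hm⟩

theorem IsPosition.token_ne (hG : G.IsPosition) {F : Formula}
    (h : G.label G.token w = some F) : G.token ≠ w :=
  (hG.adj_iff.2 (View.mem_neighborSet_of_label_eq (view_label_of_label_eq h))).ne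

theorem exists_step_setEdge (hG : G.IsPosition) {F E : Formula}
    (h : G.label G.token w = some F)
    (hs : G.view.Unfolds G.token (G.view.neighborSet G.token) s)
    (hFE : [E.dual] ∈ F.dual.reducts) :
    ∃ s', Step s s' ∧ (G.setEdge G.token w E).view.Unfolds w
      ((G.setEdge G.token w E).view.neighborSet w) s' := by
  have hne := hG.token_ne h
  exact exists_step_of_agreeOffEdge (G := G) hG hs (view_label_of_label_eq h)
    ((view_setEdge_label hne E _ _).trans (by simp [hne.symm]))
    (agreeOffEdge_view_setEdge hne E) hFE

theorem exists_step_setEdge_swap (hG : G.IsPosition) {F E : Formula}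
    (h : G.label G.token w = some F)
    (hs : G.view.Unfolds G.token (G.view.neighborSet G.token) s) (hFE : [E] ∈ F.dual.reducts) :
    ∃ s', Step s s' ∧ (G.setEdge w G.token E).view.Unfolds w
      ((G.setEdge w G.token E).view.neighborSet w) s' := by
  have hne := (hG.token_ne h).symm
  exact exists_step_of_agreeOffEdge (G := G) hG hs (view_label_of_label_eq h)
    ((view_setEdge_label hne E _ _).trans (by simp)) (agreeOffEdge_view_setEdge hne E).symm hFE

theorem exists_step_of_rawMove {H : Diagram} (hG : G.IsPosition) (hGH : G.RawMove H)
    (hs : G.view.Unfolds G.token (G.view.neighborSet G.token) s) :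
    ∃ s', Step s s' ∧ H.view.Unfolds H.token (H.view.neighborSet H.token) s' := by
  cases hGH with
  | negative w A h => exact exists_step_passTo (G := G) hG h hs
  | one w h sole hw => exact exists_step_deleteActive hG h sole hw hs
  | tensor w A B h part hp hw => exact exists_step_splitTensor hG hp hw h hs
  | plusLeft w A B h => exact exists_step_setEdge hG h hs (.inl rfl)
  | plusRight w A B h => exact exists_step_setEdge hG h hs (.inr rfl)
  | whyNot w A h n =>
    refine exists_step_setEdge_swap hG h hs ⟨n, ?_⟩
    rw [dual_dual]

end Diagram

theorem exists_step_of_move {U U' : Position} (h : Move U U') {s : Branches}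
    (hs : U.1.view.Unfolds U.1.token (U.1.view.neighborSet U.1.token) s) :
    ∃ s', Step s s' ∧ U'.1.view.Unfolds U'.1.token (U'.1.view.neighborSet U'.1.token) s' := by
  obtain ⟨H, hH, ⟨e⟩⟩ := h
  obtain ⟨s', hs', hu⟩ := Diagram.exists_step_of_rawMove U.2 hH hs
  refine ⟨s', hs', ?_⟩
  rw [← e.token_eq]
  exact hu.of_equiv e.toEquiv fun x y => by simp only [Diagram.view, e.label_eq]

theorem acc_flip_move_of_terminates {s : Branches} (h : Terminates s) {U : Position}
    (hs : U.1.view.Unfolds U.1.token (U.1.view.neighborSet U.1.token) s) : Acc (flip Move) U := by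
  induction h generalizing U with
  | intro s _ ih =>
    refine ⟨U, fun U' hUU' => ?_⟩
    obtain ⟨s', hs', hu⟩ := exists_step_of_move hUU' hs
    exact ih s' hs' hu

theorem wellFounded_flip_move : WellFounded (flip Move) := by
  refine ⟨fun U => ?_⟩
  have := U.2.finite
  obtain ⟨s, hs⟩ := U.2.isForest_view.exists_unfolds U.1.token
  exact acc_flip_move_of_terminates (terminates s) hs

end LLTN

theorem mainTheorem3 (U : LLTN.Position) (p : LLTN.Play U) : p.length < ⊤ := by
  rw [lt_top_iff_ne_top]
  intro hp
  have : IsWellFounded LLTN.Position (flip LLTN.Move) := ⟨LLTN.wellFounded_flip_move⟩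
  obtain ⟨n, hn⟩ := WellFounded.not_rel_apply_succ (r := flip LLTN.Move) p.pos
  exact hn (p.move n (hp ▸ ENat.natCast_lt_top n))
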